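/- Let $S$ be a finite non-empty set and let $\mu\colon\mathcal P(S)\to\mathbf Z$ be submodular, i.e. $\mu(A)+\mu(B)\ge\mu(A\cup B)+\mu(A\cap B)$ for all $A,B\subseteq S$, and non-decreasing, i.e. $\mu(A)\le\mu(B)$ whenever $A\subseteq B\subseteq S$. Let $$P_\mu=\Big\{x\in\mathbf R^S : x\ge 0,\ \sum_{s\in U}x_s\le\mu(U)\text{ for all }U\subseteq S\Big\},\qquad B_\mu=\Big\{x\in P_\mu : \sum_{s\in S}x_s=\mu(S)\Big\}$$ be the associated polymatroid and its base polytope. Let $\mathbf i_s$ ($s\in S$) be the standard basis vectors of $\mathbf R^S$, $\Delta_S=\mathrm{conv}\{\mathbf i_s : s\in S\}$ and $\nabla_S=\mathrm{conv}\{-\mathbf i_s : s\in S\}$. Fix a linear order on $S$. For $f\in B_\mu\cap\mathbf Z^S$, an element $e\in S$ is internally active if there is no $e'<e$ with $f-\mathbf i_e+\mathbf i_{e'}\in B_\mu$, and externally active if there is no $e'<e$ with $f+\mathbf i_e-\mathbf i_{e'}\in B_\mu$. Let $\bar\iota(f)$ and $\bar\varepsilon(f)$ be the numbers of elements of $S$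 that are not internally active and not externally active, respectively, and let $$I_\mu(x)=\sum_{f\in B_\mu\cap\mathbf Z^S}x^{\bar\iota(f)},\qquad X_\mu(x)=\sum_{f\in B_\mu\cap\mathbf Z^S}x^{\bar\varepsilon(f)}$$ be the interior and the exterior polynomial of $\mu$. Then $I_\mu$ and $X_\mu$ have degree at most $|S|-1$, the (finite) numbers of lattice points $$\left|(B_\mu+k\nabla_S)\cap\mathbf Z^S\right|\quad\text{and}\quad\left|(B_\mu+k\Delta_S)\cap\mathbf Z^S\right|\qquad(k=0,1,2,\dots)$$ are polynomials in $k$, and the coefficients of $I_\mu$ (resp. $X_\mu$) in the basis $1,x,x^2,\dots,x^{|S|-1}$ are equal to the coefficients of the first (resp. second) of these polynomials in the basis $\binom{k+|S|-1}{|S|-1},\dots,\binom{k+2}{2},k+1,1$, in this order. In particular, $I_\mu$ and $X_\mu$ do not depend on the linear order on $S$. -/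

import Mathlib

open Polynomial
open scoped Pointwise

noncomputable section

/-- The polymatroid `P_μ ⊆ ℝ^S`: nonnegative vectors `x` with `∑_{s ∈ U} x s ≤ μ U` for all `U`. -/
def polymatroid {S : Type*} (μ : Finset S → ℤ) : Set (S → ℝ) :=
  {x | (∀ s, 0 ≤ x s) ∧ ∀ U : Finset S, ∑ s ∈ U, x s ≤ (μ U : ℝ)}

/-- The base polytope `B_μ` of the polymatroid `P_μ`. -/
def basePolytope {S : Type*} [Fintype S] (μ : Finset S → ℤ) : Set (S → ℝ) :=
  {x | x ∈ polymatroid μ ∧ ∑ s, x s = (μ Finset.univ : ℝ)}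

/-- The inverted standard simplex `∇_S`; the standard simplex `Δ_S` is Mathlib's `stdSimplex ℝ S`. -/
def invertedSimplex (S : Type*) [DecidableEq S] : Set (S → ℝ) :=
  convexHull ℝ (Set.range fun s : S => -(Pi.single s 1 : S → ℝ))

/-- The lattice points `A ∩ ℤ^S` of a set `A ⊆ ℝ^S`, as integer vectors. -/
def latticePoints {S : Type*} (A : Set (S → ℝ)) : Set (S → ℤ) :=
  {z | (fun s => (z s : ℝ)) ∈ A}

theorem latticePoints_basePolytope_finite {S : Type*} [Fintype S] (μ : Finset S → ℤ) :
    (latticePoints (basePolytope μ)).Finite := by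
  classical
  refine (Set.finite_Icc (0 : S → ℤ) (fun s => μ {s})).subset ?_
  rintro z ⟨⟨h0, hU⟩, -⟩
  refine ⟨fun s => ?_, fun s => ?_⟩
  · have := h0 s
    simpa using this
  · have := hU {s}
    simpa using this

/-- The integer points of the base polytope (the generalization of hypertrees). -/
def integerBases {S : Type*} [Fintype S] (μ : Finset S → ℤ) : Finset (S → ℤ) :=
  (latticePoints_basePolytope_finite μ).toFinset

/-- The vector obtained from `f` by decreasing `f e` by `1` and increasing `f e'` by `1`. -/
def transfer {S : Type*} [DecidableEq S] (f : S → ℤ) (e e' : S) : S → ℤ :=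
  f - Pi.single e 1 + Pi.single e' 1

/-- `e` is internally active at `f` with respect to the order `o`: no transfer from `e` to a smaller
element results in an integer base. -/
def InternallyActive {S : Type*} [Fintype S] [DecidableEq S] (μ : Finset S → ℤ)
    (o : LinearOrder S) (f : S → ℤ) (e : S) : Prop :=
  ∀ e' : S, o.lt e' e → transfer f e e' ∉ integerBases μ

/-- `e` is externally active at `f` with respect to the order `o`: no transfer to `e` from a smaller
element results in an integer base. -/
def ExternallyActive {S : Type*} [Fintype S] [DecidableEq S] (μ : Finset S → ℤ)
    (o : LinearOrder S) (f : S → ℤ) (e : S) : Prop :=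
  ∀ e' : S, o.lt e' e → transfer f e' e ∉ integerBases μ

open scoped Classical in
/-- The number of internally inactive elements. -/
def internalInactivity {S : Type*} [Fintype S] [DecidableEq S] (μ : Finset S → ℤ)
    (o : LinearOrder S) (f : S → ℤ) : ℕ :=
  (Finset.univ.filter fun e => ¬ InternallyActive μ o f e).card

open scoped Classical in
/-- The number of externally inactive elements. -/
def externalInactivity {S : Type*} [Fintype S] [DecidableEq S] (μ : Finset S → ℤ)
    (o : LinearOrder S) (f : S → ℤ) : ℕ :=
  (Finset.univ.filter fun e => ¬ ExternallyActive μ o f e).card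

/-- The interior polynomial `I_μ`, computed with the order `o`. -/
def interiorPolynomial {S : Type*} [Fintype S] [DecidableEq S] (μ : Finset S → ℤ)
    (o : LinearOrder S) : ℤ[X] :=
  ∑ f ∈ integerBases μ, X ^ internalInactivity μ o f

/-- The exterior polynomial `X_μ`, computed with the order `o`. -/
def exteriorPolynomial {S : Type*} [Fintype S] [DecidableEq S] (μ : Finset S → ℤ)
    (o : LinearOrder S) : ℤ[X] :=
  ∑ f ∈ integerBases μ, X ^ externalInactivity μ o f

/-- The polynomial `(k + d choose d)` in the variable `k`. -/
def binomPoly (d : ℕ) : ℚ[X] := preHilbertPoly ℚ d 0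

theorem binomPoly_eval (d k : ℕ) : (binomPoly d).eval (k : ℚ) = ((k + d).choose d : ℚ) := by
  simpa [binomPoly] using preHilbertPoly_eq_choose_sub_add ℚ d (Nat.zero_le k)

end

/-!
For an M-convex set `B` of integer vectors, assign to every `g ∈ B + k Δ` the lexicographically
smallest `f ∈ B` below it. The exchange property identifies the vectors assigned to `f` as the
`f + h` with `h ≥ 0` of total `k` supported on the externally active elements of `f`, so `B + k Δ`
is a disjoint union of dilated lattice simplices, one for each `f ∈ B`, whose dimensions are
prescribed by the activities. Summing the binomial coefficients that count them turns the activity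
generating polynomial into the counting polynomial. Integer bases of a submodular function are
M-convex by uncrossing tight sets; the same uncrossing moves real bases to integer ones, which
reduces lattice points of Minkowski sums to sums of lattice points. The interior polynomial is the
exterior polynomial of the M-convex set `-B`.
-/

section Transfer

variable {S : Type*} [DecidableEq S]

theorem transfer_apply (f : S → ℤ) (i j s : S) :
    transfer f i j s = f s - (if s = i then 1 else 0) + (if s = j then 1 else 0) := by
  simp [transfer, Pi.single_apply]

theorem transfer_transfer_swap (f : S → ℤ) (i j : S) : transfer (transfer f i j) j i = f := by
  simp [transfer]

theorem sum_transfer (f : S → ℤ) (i j : S) (U : Finset S) :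
    ∑ s ∈ U, transfer f i j s =
      ∑ s ∈ U, f s - (if i ∈ U then 1 else 0) + (if j ∈ U then 1 else 0) := by
  simp [transfer_apply, Finset.sum_add_distrib]

theorem transfer_mem_neg [Fintype S] {B : Finset (S → ℤ)} {f : S → ℤ} {i j : S} :
    transfer f i j ∈ -B ↔ transfer (-f) j i ∈ B := by
  have h : -transfer f i j = transfer (-f) j i := by simp only [transfer]; abel
  rw [Finset.mem_neg', h]

theorem sum_toNat_transfer_sub_lt [Fintype S] {f g : S → ℤ} {i j : S} (hi : g i < f i)
    (hj : f j < g j) :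
    ∑ s, (transfer f i j s - g s).toNat < ∑ s, (f s - g s).toNat := by
  have hij : i ≠ j := by rintro rfl; exact hi.not_gt hj
  refine Finset.sum_lt_sum (fun s _ => ?_) ⟨i, Finset.mem_univ i, ?_⟩
  · rw [transfer_apply]
    by_cases hs : s = j
    · subst hs; split_ifs <;> omega
    · split_ifs <;> omega
  · simp only [transfer_apply, hij, if_true, if_false]
    omega

end Transfer

/-- Discrete convexity in the sense of Murota (one half of the exchange property suffices): a finite
set of integer vectors is M-convex if any two members can be moved towards each other by transfers.
-/
def IsMConvex {S : Type*} [DecidableEq S] (B : Finset (S → ℤ)) : Prop :=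
  ∀ ⦃f⦄, f ∈ B → ∀ ⦃g⦄, g ∈ B → ∀ ⦃i⦄, g i < f i → ∃ j, f j < g j ∧ transfer f i j ∈ B

namespace IsMConvex

variable {S : Type*} [DecidableEq S] {B : Finset (S → ℤ)} {f g : S → ℤ}

theorem eq_of_le (hB : IsMConvex B) (hf : f ∈ B) (hg : g ∈ B) (hfg : f ≤ g) : f = g := by
  refine le_antisymm hfg fun i => ?_
  by_contra! hi
  obtain ⟨j, hj, -⟩ := hB hg hf hi
  exact (hfg j).not_gt hj

theorem sum_eq [Fintype S] (hB : IsMConvex B) (hf : f ∈ B) (hg : g ∈ B) : ∑ s, f s = ∑ s, g s := by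
  induction hd : ∑ s, (f s - g s).toNat using Nat.strong_induction_on generalizing f with
  | _ d ih =>
    by_cases hfg : f ≤ g
    · rw [hB.eq_of_le hf hg hfg]
    · obtain ⟨i, hi⟩ : ∃ i, g i < f i := by simpa [Pi.le_def] using hfg
      obtain ⟨j, hj, hmem⟩ := hB hf hg hi
      rw [← ih _ (hd ▸ sum_toNat_transfer_sub_lt hi hj) hmem rfl, sum_transfer]
      simp

theorem exists_transfer_to [Finite S] (hB : IsMConvex B) (hf : f ∈ B) (hg : g ∈ B) {i : S}
    (hi : f i < g i) : ∃ j, g j < f j ∧ transfer f j i ∈ B := by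
  have := Fintype.ofFinite S
  induction hd : ∑ s, (g s - f s).toNat using Nat.strong_induction_on generalizing g with
  | _ d ih =>
    -- Move `g` towards `f` for as long as it can stay above `f` at `i`.
    by_cases hk : ∃ k, f k < g k ∧ (k = i → f i + 1 < g i)
    · obtain ⟨k, hk, hki⟩ := hk
      obtain ⟨j, hj, hmem⟩ := hB hg hf hk
      have hi' : f i < transfer g k j i := by
        rw [transfer_apply]
        split_ifs <;> grind
      obtain ⟨j', hj', hmem'⟩ := ih _ (hd ▸ sum_toNat_transfer_sub_lt hk hj) hmem hi' rfl
      refine ⟨j', ?_, hmem'⟩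
      rw [transfer_apply] at hj'
      split_ifs at hj' <;> grind
    · push Not at hk
      obtain ⟨j, hj, hmem⟩ := hB hg hf hi
      have hle : transfer g i j ≤ f := fun s => by
        have := hk s
        rw [transfer_apply]
        split_ifs <;> grind
      refine ⟨j, hj, ?_⟩
      rwa [← hB.eq_of_le hmem hf hle, transfer_transfer_swap]

protected theorem neg [Fintype S] (hB : IsMConvex B) : IsMConvex (-B) := by
  intro f hf g hg i hi
  obtain ⟨j, hj, hmem⟩ := hB.exists_transfer_to (Finset.mem_neg'.1 hf) (Finset.mem_neg'.1 hg)
    (i := i) (by simpa using hi)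
  exact ⟨j, by simpa using hj, transfer_mem_neg.2 hmem⟩

end IsMConvex

section LatticeSimplex

variable {S : Type*} [DecidableEq S]

/-- The lattice points of the `k`-fold dilation of the face of the standard simplex spanned by
`T`. -/
def latticeSimplex (T : Finset S) (k : ℕ) : Finset (S → ℤ) :=
  (T.piAntidiag k).map Nat.castEmbedding.arrowCongrRight

theorem mem_latticeSimplex [Fintype S] {T : Finset S} {k : ℕ} {h : S → ℤ} :
    h ∈ latticeSimplex T k ↔ 0 ≤ h ∧ ∑ s, h s = k ∧ ∀ s, h s ≠ 0 → s ∈ T := by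
  have hmem (h : S → ℕ) : h ∈ T.piAntidiag k ↔ ∑ s, h s = k ∧ ∀ s, h s ≠ 0 → s ∈ T := by
    rw [Finset.mem_piAntidiag]
    refine and_congr_left fun hT => ?_
    rw [Finset.sum_subset T.subset_univ fun s _ hs => not_not.1 (mt (hT s) hs)]
  simp only [latticeSimplex, Finset.mem_map, hmem]
  constructor
  · rintro ⟨h, ⟨hsum, hT⟩, rfl⟩
    exact ⟨fun s => Int.natCast_nonneg (h s), by simp [← hsum], by simpa using hT⟩
  · rintro ⟨h0, hsum, hT⟩
    lift h to S → ℕ using h0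
    exact ⟨h, ⟨by simpa [← Nat.cast_sum] using hsum, by simpa using hT⟩, rfl⟩

theorem card_latticeSimplex {T : Finset S} (hT : T.Nonempty) (k : ℕ) :
    ((latticeSimplex T k).card : ℚ) = (binomPoly (T.card - 1)).eval (k : ℚ) := by
  have hcard : (T.piAntidiag k).card = (T.card + k - 1).choose k := by
    rw [← Finset.card_finsuppAntidiag_nat_eq_choose]
    simp [Finset.finsuppAntidiag]
  have := hT.card_pos
  rw [latticeSimplex, Finset.card_map, hcard, binomPoly_eval, ← Nat.choose_symm_add]
  congr 2
  omega

end LatticeSimplex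

section Activity

variable {S : Type*} [Fintype S] [DecidableEq S]

open scoped Classical in
/-- The externally active elements of `f` with respect to `o`, for an arbitrary finite set `B` of
integer vectors in place of the integer bases. -/
def activeElements (B : Finset (S → ℤ)) (o : LinearOrder S) (f : S → ℤ) : Finset S :=
  Finset.univ.filter fun e => ∀ e', o.lt e' e → transfer f e' e ∉ B

theorem mem_activeElements {B : Finset (S → ℤ)} {o : LinearOrder S} {f : S → ℤ} {e : S} :
    e ∈ activeElements B o f ↔ ∀ e', o.lt e' e → transfer f e' e ∉ B := by
  simp [activeElements]

theorem activeElements_nonempty [Nonempty S] (B : Finset (S → ℤ)) (o : LinearOrder S)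
    (f : S → ℤ) : (activeElements B o f).Nonempty := by
  let := o
  obtain ⟨m, hm⟩ := Finite.exists_min (id : S → S)
  exact ⟨m, mem_activeElements.2 fun e he => absurd (hm e) (not_le.2 he)⟩

theorem externalInactivity_eq_card_compl (μ : Finset S → ℤ) (o : LinearOrder S) (f : S → ℤ) :
    externalInactivity μ o f = (activeElements (integerBases μ) o f)ᶜ.card := by
  rw [externalInactivity]
  congr 1
  ext e
  simp [mem_activeElements, ExternallyActive]

theorem internalInactivity_eq_card_compl (μ : Finset S → ℤ) (o : LinearOrder S) (f : S → ℤ) :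
    internalInactivity μ o f = (activeElements (-integerBases μ) o (-f))ᶜ.card := by
  rw [internalInactivity]
  congr 1
  ext e
  simp only [Finset.mem_filter, Finset.mem_univ, true_and, Finset.mem_compl, mem_activeElements]
  simp only [InternallyActive, transfer_mem_neg, neg_neg]

variable {B : Finset (S → ℤ)} (o : LinearOrder S) {f g : S → ℤ}

theorem exists_le_forall_lt_mem_activeElements (hf : f ∈ B) (hfg : f ≤ g) :
    ∃ f' ∈ B, f' ≤ g ∧ ∀ s, f' s < g s → s ∈ activeElements B o f' := by
  classical
  let := o
  obtain ⟨f', hf', hmin⟩ := Finset.exists_min_image (B.filter (· ≤ g)) toLex ⟨f, by simp [hf, hfg]⟩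
  obtain ⟨hf'B, hf'g⟩ := Finset.mem_filter.1 hf'
  refine ⟨f', hf'B, hf'g, fun e he => mem_activeElements.2 fun e' hlt hmem => ?_⟩
  have hle : transfer f' e' e ≤ g := fun s => by
    have := hf'g s
    rw [transfer_apply]
    split_ifs <;> grind
  have hlex : toLex (transfer f' e' e) < toLex f' := by
    refine ⟨e', fun s hs => ?_, ?_⟩
    · simp [transfer_apply, hs.ne, (hs.trans hlt).ne]
    · simp [transfer_apply, hlt.ne]
  exact (hmin _ (Finset.mem_filter.2 ⟨hmem, hle⟩)).not_gt hlex

theorem IsMConvex.eq_of_forall_lt_mem_activeElements (hB : IsMConvex B) {f₁ f₂ : S → ℤ}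
    (hf₁ : f₁ ∈ B) (hf₂ : f₂ ∈ B) (hle₁ : f₁ ≤ g) (hle₂ : f₂ ≤ g)
    (hact₁ : ∀ s, f₁ s < g s → s ∈ activeElements B o f₁)
    (hact₂ : ∀ s, f₂ s < g s → s ∈ activeElements B o f₂) : f₁ = f₂ := by
  let := o
  by_contra hne
  wlog hlex : toLex f₁ < toLex f₂ generalizing f₁ f₂
  · exact this hf₂ hf₁ hle₂ hle₁ hact₂ hact₁ (Ne.symm hne)
      ((not_lt.1 hlex).lt_of_ne fun h => hne (toLex.injective h).symm)
  obtain ⟨i, heq, hi⟩ := hlex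
  obtain ⟨j, hj, hmem⟩ := hB hf₂ hf₁ hi
  have hij : i < j := by
    by_contra! hji
    rcases hji.eq_or_lt with rfl | hji
    · exact hi.not_gt hj
    · exact hj.ne' (heq j hji)
  exact mem_activeElements.1 (hact₂ j (hj.trans_le (hle₁ j))) i hij hmem

theorem mem_vadd_latticeSimplex_activeElements {k : ℕ} :
    g ∈ f +ᵥ latticeSimplex (activeElements B o f) k ↔
      f ≤ g ∧ ∑ s, g s = ∑ s, f s + k ∧ ∀ s, f s < g s → s ∈ activeElements B o f := by
  rw [← Finset.neg_vadd_mem_iff, mem_latticeSimplex, vadd_eq_add, neg_add_eq_sub, sub_nonneg]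
  refine and_congr_right fun hfg => and_congr ?_ (forall_congr' fun s => ?_)
  · simp [Finset.sum_sub_distrib, sub_eq_iff_eq_add']
  · simp [sub_ne_zero, (hfg s).lt_iff_ne, ne_comm]

namespace IsMConvex

theorem add_latticeSimplex_univ (hB : IsMConvex B) (k : ℕ) :
    B + latticeSimplex Finset.univ k =
      B.biUnion fun f => f +ᵥ latticeSimplex (activeElements B o f) k := by
  ext g
  simp only [Finset.mem_biUnion, mem_vadd_latticeSimplex_activeElements]
  constructor
  · intro hg
    obtain ⟨f₀, hf₀, h, hh, rfl⟩ := Finset.mem_add.1 hg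
    obtain ⟨h0, hsum, -⟩ := mem_latticeSimplex.1 hh
    obtain ⟨f, hf, hle, hact⟩ :=
      exists_le_forall_lt_mem_activeElements o hf₀ (le_add_of_nonneg_right h0)
    exact ⟨f, hf, hle, by simp [Finset.sum_add_distrib, hsum, hB.sum_eq hf hf₀], hact⟩
  · rintro ⟨f, hf, hle, hsum, -⟩
    refine Finset.mem_add.2 ⟨f, hf, g - f, mem_latticeSimplex.2 ?_, add_sub_cancel f g⟩
    simp [hle, Finset.sum_sub_distrib, hsum]

theorem card_add_latticeSimplex_univ (hB : IsMConvex B) (k : ℕ) :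
    (B + latticeSimplex Finset.univ k).card =
      ∑ f ∈ B, (latticeSimplex (activeElements B o f) k).card := by
  have hdisj : (B : Set (S → ℤ)).PairwiseDisjoint
      fun f => f +ᵥ latticeSimplex (activeElements B o f) k := by
    intro f₁ hf₁ f₂ hf₂ hne
    refine Finset.disjoint_left.2 fun g hg₁ hg₂ => hne ?_
    obtain ⟨hle₁, -, hact₁⟩ := (mem_vadd_latticeSimplex_activeElements o).1 hg₁
    obtain ⟨hle₂, -, hact₂⟩ := (mem_vadd_latticeSimplex_activeElements o).1 hg₂
    exact hB.eq_of_forall_lt_mem_activeElements o hf₁ hf₂ hle₁ hle₂ hact₁ hact₂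
  rw [hB.add_latticeSimplex_univ o, Finset.card_biUnion hdisj]
  simp only [Finset.card_vadd_finset]

end IsMConvex

end Activity

section BinomialTransform

theorem degree_binomPoly (d : ℕ) : (binomPoly d).degree = d := by
  have h0 : binomPoly d ≠ 0 := by
    rw [← leadingCoeff_ne_zero, binomPoly, leadingCoeff_preHilbertPoly]
    positivity
  rw [degree_eq_natDegree h0, binomPoly, natDegree_preHilbertPoly]

/-- The polynomial whose coefficients in the basis `(k + n - 1 choose n - 1), …, k + 1, 1` are the
first `n` coefficients of `p` in the basis `1, x, …, x ^ (n - 1)`. -/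
noncomputable def binomialTransform (n : ℕ) (p : ℤ[X]) : ℚ[X] :=
  ∑ i : Fin n, C (p.coeff i : ℚ) * binomPoly (n - 1 - i)

theorem binomialTransform_sum_X_pow {ι : Type*} {B : Finset ι} {w : ι → ℕ} {n : ℕ}
    (hw : ∀ f ∈ B, w f < n) :
    binomialTransform n (∑ f ∈ B, X ^ w f) = ∑ f ∈ B, binomPoly (n - 1 - w f) := by
  simp only [binomialTransform, finsetSum_coeff, Int.cast_sum, map_sum, Finset.sum_mul]
  rw [Finset.sum_comm]
  refine Finset.sum_congr rfl fun f hf => ?_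
  rw [Finset.sum_eq_single ⟨w f, hw f hf⟩] <;> simp +contextual [coeff_X_pow, Fin.ext_iff]

theorem binomialTransform_eq_iff {n : ℕ} {p : ℤ[X]} {a : Fin n → ℚ} :
    binomialTransform n p = ∑ i, C (a i) * binomPoly (n - 1 - (i : ℕ)) ↔
      ∀ i, a i = (p.coeff (i : ℕ) : ℚ) := by
  have hrev : Function.Injective fun i : Fin n => n - 1 - (i : ℕ) := fun i j hij => by
    dsimp only at hij
    omega
  have hli : LinearIndependent ℚ fun i : Fin n => binomPoly (n - 1 - (i : ℕ)) :=
    (⟨binomPoly, degree_binomPoly⟩ : Polynomial.Sequence ℚ).linearIndependent.comp _ hrev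
  simp only [binomialTransform, ← smul_eq_C_mul]
  rw [← funext_iff, eq_comm]
  exact hli.fintypeLinearCombination_injective.eq_iff

theorem eq_of_binomialTransform_eq {n : ℕ} {p q : ℤ[X]} (hp : p.natDegree < n)
    (hq : q.natDegree < n) (h : binomialTransform n p = binomialTransform n q) : p = q := by
  ext i
  by_cases hi : i < n
  · exact_mod_cast (binomialTransform_eq_iff.1 h ⟨i, hi⟩).symm
  · rw [coeff_eq_zero_of_natDegree_lt (by omega), coeff_eq_zero_of_natDegree_lt (by omega)]

end BinomialTransform

section ActivityPolynomial

variable {S : Type*} [Fintype S] [DecidableEq S]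

/-- The generating polynomial of external inactivity over an arbitrary finite set `B` of integer
vectors. -/
noncomputable def activityPolynomial (B : Finset (S → ℤ)) (o : LinearOrder S) : ℤ[X] :=
  ∑ f ∈ B, X ^ (activeElements B o f)ᶜ.card

theorem exteriorPolynomial_eq_activityPolynomial (μ : Finset S → ℤ) (o : LinearOrder S) :
    exteriorPolynomial μ o = activityPolynomial (integerBases μ) o := by
  simp only [exteriorPolynomial, activityPolynomial, externalInactivity_eq_card_compl]

theorem interiorPolynomial_eq_activityPolynomial (μ : Finset S → ℤ) (o : LinearOrder S) :
    interiorPolynomial μ o = activityPolynomial (-integerBases μ) o := by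
  simp only [interiorPolynomial, activityPolynomial, internalInactivity_eq_card_compl,
    Finset.sum_neg_index]

variable [Nonempty S] {B : Finset (S → ℤ)}

theorem card_compl_activeElements_lt (B : Finset (S → ℤ)) (o : LinearOrder S) (f : S → ℤ) :
    (activeElements B o f)ᶜ.card < Fintype.card S := by
  rw [Finset.card_compl_lt_iff_nonempty]
  exact activeElements_nonempty B o f

theorem natDegree_activityPolynomial_lt (B : Finset (S → ℤ)) (o : LinearOrder S) :
    (activityPolynomial B o).natDegree < Fintype.card S := by
  refine Nat.lt_of_le_sub_one Fintype.card_pos (natDegree_sum_le_of_forall_le _ _ fun f _ => ?_)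
  rw [natDegree_X_pow]
  exact Nat.le_sub_one_of_lt (card_compl_activeElements_lt B o f)

namespace IsMConvex

theorem eval_binomialTransform_activityPolynomial (hB : IsMConvex B) (o : LinearOrder S) (k : ℕ) :
    (binomialTransform (Fintype.card S) (activityPolynomial B o)).eval (k : ℚ) =
      (B + latticeSimplex Finset.univ k).card := by
  rw [activityPolynomial,
    binomialTransform_sum_X_pow fun f _ => card_compl_activeElements_lt B o f, eval_finsetSum,
    hB.card_add_latticeSimplex_univ o, Nat.cast_sum]
  refine Finset.sum_congr rfl fun f _ => ?_
  have := (activeElements B o f).card_add_card_compl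
  rw [card_latticeSimplex (activeElements_nonempty B o f)]
  congr 2
  omega

theorem activityPolynomial_eq (hB : IsMConvex B) (o o' : LinearOrder S) :
    activityPolynomial B o = activityPolynomial B o' := by
  refine eq_of_binomialTransform_eq (natDegree_activityPolynomial_lt B o)
    (natDegree_activityPolynomial_lt B o') (eq_of_infinite_eval_eq _ _ ?_)
  refine (Set.infinite_range_of_injective (Nat.cast_injective (R := ℚ))).mono ?_
  rintro _ ⟨k, rfl⟩
  exact (hB.eval_binomialTransform_activityPolynomial o k).trans
    (hB.eval_binomialTransform_activityPolynomial o' k).symm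

theorem eval_binomialTransform_activityPolynomial_neg (hB : IsMConvex B) (o : LinearOrder S)
    (k : ℕ) :
    (binomialTransform (Fintype.card S) (activityPolynomial (-B) o)).eval (k : ℚ) =
      (B - latticeSimplex Finset.univ k).card := by
  rw [hB.neg.eval_binomialTransform_activityPolynomial, ← Finset.card_neg, neg_add, neg_neg,
    ← sub_eq_add_neg]

end IsMConvex

end ActivityPolynomial

section Tight

variable {S : Type*} {μ : Finset S → ℤ} {f : S → ℤ}

/-- The sets on which the constraint of the polymatroid is an equality at `f`. The empty set counts
as tight whatever `μ ∅` is, because its constraint does not involve `f`. -/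
def IsTight (μ : Finset S → ℤ) (f : S → ℤ) (T : Finset S) : Prop :=
  T = ∅ ∨ ∑ s ∈ T, f s = μ T

theorem IsTight.sum_le {R : Type*} [Ring R] [LinearOrder R] [IsStrictOrderedRing R]
    {T : Finset S} (hT : IsTight μ f T) {x : S → R} (hx : ∑ s ∈ T, x s ≤ μ T) :
    ∑ s ∈ T, x s ≤ ∑ s ∈ T, (f s : R) := by
  obtain rfl | hT := hT
  · simp
  · exact hx.trans_eq (by rw [← hT, Int.cast_sum])

theorem exists_isTight_of_maximal {c : S → ℤ} {e : S}
    (hf : Maximal (fun f => f ≤ c ∧ ∀ U : Finset S, ∑ s ∈ U, f s ≤ μ U) f) (he : f e < c e) :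
    ∃ T, e ∈ T ∧ IsTight μ f T := by
  classical
  obtain ⟨⟨hfc, hfU⟩, hmax⟩ := hf
  by_contra! hcon
  have hle := hmax (y := f + Pi.single e 1) ⟨fun s => ?_, fun U => ?_⟩
    (le_add_of_nonneg_right (by simp)) e
  · simp at hle
  · have := hfc s
    by_cases hs : s = e
    · subst hs; simpa using he
    · simpa [hs] using this
  · have hU := hfU U
    have hne (heU : e ∈ U) : ∑ s ∈ U, f s ≠ μ U := fun heq => hcon U heU (.inr heq)
    simp only [Pi.add_apply, Finset.sum_add_distrib, Pi.single_apply, Finset.sum_ite_eq']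
    split_ifs <;> grind

variable [DecidableEq S] (hsub : ∀ A B : Finset S, μ (A ∪ B) + μ (A ∩ B) ≤ μ A + μ B)
  (hf : ∀ U : Finset S, ∑ s ∈ U, f s ≤ μ U)
include hsub hf

theorem IsTight.union {A B : Finset S} (hA : IsTight μ f A) (hB : IsTight μ f B) :
    IsTight μ f (A ∪ B) := by
  obtain rfl | hA := hA
  · rwa [Finset.empty_union]
  obtain rfl | hB := hB
  · rw [Finset.union_empty]
    exact .inr hA
  refine .inr ((hf _).antisymm ?_)
  have := Finset.sum_union_inter (s₁ := A) (s₂ := B) (f := f)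
  linarith [hsub A B, hf (A ∩ B)]

theorem exists_isTight_superset {E V : Finset S}
    (hE : ∀ e ∈ E, ∃ T ⊆ V, e ∈ T ∧ IsTight μ f T) : ∃ T ⊆ V, E ⊆ T ∧ IsTight μ f T := by
  choose! T hTV heT hT using hE
  refine ⟨E.sup T, Finset.sup_le hTV, fun e he => Finset.le_sup (f := T) he (heT e he), ?_⟩
  exact Finset.sup_induction (.inl rfl) (fun A hA B hB => hA.union hsub hf hB) hT

end Tight

section IntegerBases

variable {S : Type*} [Fintype S] {μ : Finset S → ℤ}

theorem mem_integerBases_iff_cast_mem_basePolytope {f : S → ℤ} :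
    f ∈ integerBases μ ↔ (fun s => (f s : ℝ)) ∈ basePolytope μ := by
  rw [integerBases, Set.Finite.mem_toFinset]
  rfl

theorem mem_integerBases {f : S → ℤ} :
    f ∈ integerBases μ ↔
      (∀ s, 0 ≤ f s) ∧ (∀ U : Finset S, ∑ s ∈ U, f s ≤ μ U) ∧ ∑ s, f s = μ Finset.univ := by
  simp only [mem_integerBases_iff_cast_mem_basePolytope, basePolytope, polymatroid,
    Set.mem_ofPred_eq, and_assoc]
  norm_cast

variable [DecidableEq S]

theorem exists_isTight_of_transfer_notMem {f : S → ℤ} {i j : S} (hf : f ∈ integerBases μ)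
    (hi : 0 < f i) (h : transfer f i j ∉ integerBases μ) :
    ∃ T ⊆ {i}ᶜ, j ∈ T ∧ IsTight μ f T := by
  obtain ⟨h0, hU, hS⟩ := mem_integerBases.1 hf
  by_contra! hcon
  refine h (mem_integerBases.2 ⟨fun s => ?_, fun U => ?_, by simp [sum_transfer, hS]⟩)
  · have := h0 s
    rw [transfer_apply]
    split_ifs <;> grind
  · have hle := hU U
    have hne (hj : j ∈ U) (hi : i ∉ U) : ∑ s ∈ U, f s ≠ μ U := fun heq =>
      hcon U (by simpa using hi) hj (.inr heq)
    rw [sum_transfer]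
    split_ifs <;> grind

variable (hsub : ∀ A B : Finset S, μ (A ∪ B) + μ (A ∩ B) ≤ μ A + μ B)
include hsub

theorem isMConvex_integerBases : IsMConvex (integerBases μ) := by
  intro f hf g hg i hi
  obtain ⟨-, hfU, hfS⟩ := mem_integerBases.1 hf
  obtain ⟨hg0, hgU, hgS⟩ := mem_integerBases.1 hg
  by_contra! hcon
  obtain ⟨T, hTi, hlt, hT⟩ := exists_isTight_superset hsub hfU (E := {j | f j < g j})
    fun j hj => exists_isTight_of_transfer_notMem hf ((hg0 i).trans_lt hi)
      (hcon j (Finset.mem_filter_univ j |>.1 hj))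
  have hsumT : ∑ s ∈ T, g s ≤ ∑ s ∈ T, f s := by simpa using hT.sum_le (hgU T)
  have hsumTc : ∑ s ∈ Tᶜ, g s < ∑ s ∈ Tᶜ, f s := by
    refine Finset.sum_lt_sum (fun s hs => ?_) ⟨i, by simpa using hTi, hi⟩
    by_contra! hs'
    exact Finset.mem_compl.1 hs (hlt (by simpa using hs'))
  have hsum : ∑ s, g s < ∑ s, f s := by
    rw [← Finset.sum_add_sum_compl T f, ← Finset.sum_add_sum_compl T g]
    exact add_lt_add_of_le_of_lt hsumT hsumTc
  exact hsum.ne (hgS.trans hfS.symm)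

theorem exists_integerBase_between {b : S → ℝ} (hb : b ∈ basePolytope μ) {l c : S → ℤ}
    (hl : ∀ s, (l s : ℝ) ≤ b s) (hc : ∀ s, b s ≤ c s) : ∃ f ∈ integerBases μ, l ≤ f ∧ f ≤ c := by
  obtain ⟨⟨hb0, hbU⟩, hbS⟩ := hb
  have hlb (s : S) : (((l ⊔ 0) s : ℤ) : ℝ) ≤ b s := by simp [hl s, hb0 s]
  have hmem : l ⊔ 0 ≤ c ∧ ∀ U : Finset S, ∑ s ∈ U, (l ⊔ 0) s ≤ μ U := by
    refine ⟨fun s => ?_, fun U => ?_⟩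
    · exact_mod_cast (hlb s).trans (hc s)
    · exact_mod_cast (Finset.sum_le_sum fun s _ => hlb s).trans (hbU U)
  have hfin : {f | l ⊔ 0 ≤ f ∧ f ≤ c ∧ ∀ U : Finset S, ∑ s ∈ U, f s ≤ μ U}.Finite :=
    (Set.finite_Icc (l ⊔ 0) c).subset fun f hf => ⟨hf.1, hf.2.1⟩
  obtain ⟨f, hlf, ⟨-, hfc, hfU⟩, hmax⟩ := hfin.exists_le_maximal ⟨le_rfl, hmem⟩
  obtain ⟨T, -, hlt, hT⟩ := exists_isTight_superset hsub hfU (E := {e | f e < c e})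
    (V := Finset.univ) fun e he => by
      obtain ⟨T, heT, hT⟩ := exists_isTight_of_maximal
        ⟨⟨hfc, hfU⟩, fun y hy hfy => hmax ⟨hlf.trans hfy, hy⟩ hfy⟩
        (Finset.mem_filter_univ e |>.1 he)
      exact ⟨T, T.subset_univ, heT, hT⟩
  have hsumTc : ∑ s ∈ Tᶜ, b s ≤ ∑ s ∈ Tᶜ, (f s : ℝ) := by
    refine Finset.sum_le_sum fun s hs => (hc s).trans ?_
    by_contra! hs'
    exact Finset.mem_compl.1 hs (hlt (by simpa using hs'))
  have hsum : (μ Finset.univ : ℝ) ≤ ∑ s, (f s : ℝ) := by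
    rw [← hbS, ← Finset.sum_add_sum_compl T b, ← Finset.sum_add_sum_compl T]
    exact add_le_add (hT.sum_le (hbU T)) hsumTc
  obtain ⟨hle, h0⟩ := sup_le_iff.1 hlf
  exact ⟨f, mem_integerBases.2 ⟨h0, hfU, (hfU _).antisymm (mod_cast hsum)⟩, hle, hfc⟩

end IntegerBases

section LatticePoints

variable {S : Type*} [Fintype S]

theorem invertedSimplex_eq_neg [DecidableEq S] : invertedSimplex S = -stdSimplex ℝ S := by
  rw [invertedSimplex, ← convexHull_rangle_single_eq_stdSimplex, ← convexHull_neg]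
  congr 1
  ext x
  simp [neg_eq_iff_eq_neg, eq_neg_iff_add_eq_zero, add_comm]

variable [Nonempty S]

theorem mem_smul_stdSimplex {𝕜 : Type*} [Field 𝕜] [LinearOrder 𝕜] [IsStrictOrderedRing 𝕜] {r : 𝕜}
    (hr : 0 ≤ r) {y : S → 𝕜} : y ∈ r • stdSimplex 𝕜 S ↔ 0 ≤ y ∧ ∑ s, y s = r := by
  classical
  constructor
  · rintro ⟨x, ⟨hx, hx1⟩, rfl⟩
    exact ⟨fun s => mul_nonneg hr (hx s), by simp [← Finset.mul_sum, hx1]⟩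
  · rintro ⟨hy, rfl⟩
    obtain h0 | hpos := hr.eq_or_lt
    · have hy0 : y = 0 := by simpa [Fintype.sum_eq_zero_iff_of_nonneg hy] using h0.symm
      exact ⟨Pi.single (Classical.arbitrary S) 1, single_mem_stdSimplex 𝕜 _, by simp [hy0]⟩
    · refine ⟨(∑ s, y s)⁻¹ • y, ⟨fun s => mul_nonneg (inv_nonneg.2 hr) (hy s), ?_⟩,
        smul_inv_smul₀ hpos.ne' y⟩
      simp [← Finset.mul_sum, hpos.ne']

variable [DecidableEq S]

theorem cast_mem_smul_stdSimplex {k : ℕ} {h : S → ℤ} :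
    (fun s => (h s : ℝ)) ∈ (k : ℝ) • stdSimplex ℝ S ↔ h ∈ latticeSimplex Finset.univ k := by
  simp only [mem_smul_stdSimplex k.cast_nonneg, mem_latticeSimplex, Finset.mem_univ,
    implies_true, and_true, Pi.le_def, Pi.zero_apply]
  norm_cast

variable {μ : Finset S → ℤ} (hsub : ∀ A B : Finset S, μ (A ∪ B) + μ (A ∩ B) ≤ μ A + μ B)
include hsub

theorem latticePoints_add_smul_stdSimplex (k : ℕ) :
    latticePoints (basePolytope μ + (k : ℝ) • stdSimplex ℝ S) =
      ((integerBases μ + latticeSimplex Finset.univ k : Finset (S → ℤ)) : Set (S → ℤ)) := by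
  ext g
  rw [Finset.mem_coe]
  constructor
  · rintro ⟨b, hb, y, hy, hbg⟩
    obtain ⟨hy0, hysum⟩ := (mem_smul_stdSimplex k.cast_nonneg).1 hy
    have hbg (s : S) : b s + y s = g s := congrFun hbg s
    obtain ⟨f, hf, -, hfg⟩ := exists_integerBase_between hsub hb (l := 0) (c := g)
      (by simpa using hb.1.1) fun s => hbg s ▸ le_add_of_nonneg_right (hy0 s)
    have hsum : ∑ s, g s = μ Finset.univ + k := by
      rify
      simp only [← hbg, Finset.sum_add_distrib, hb.2, hysum]
    obtain ⟨-, -, hfS⟩ := mem_integerBases.1 hf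
    refine Finset.mem_add.2 ⟨f, hf, g - f, mem_latticeSimplex.2 ?_, add_sub_cancel f g⟩
    simp [hfg, hfS, hsum]
  · intro hg
    obtain ⟨f, hf, h, hh, rfl⟩ := Finset.mem_add.1 hg
    refine ⟨_, mem_integerBases_iff_cast_mem_basePolytope.1 hf, _,
      cast_mem_smul_stdSimplex.2 hh, ?_⟩
    ext s
    simp

theorem latticePoints_add_smul_invertedSimplex (k : ℕ) :
    latticePoints (basePolytope μ + (k : ℝ) • invertedSimplex S) =
      ((integerBases μ - latticeSimplex Finset.univ k : Finset (S → ℤ)) : Set (S → ℤ)) := by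
  rw [invertedSimplex_eq_neg, Set.smul_set_neg, ← sub_eq_add_neg]
  ext g
  rw [Finset.mem_coe]
  constructor
  · rintro ⟨b, hb, y, hy, hbg⟩
    obtain ⟨hy0, hysum⟩ := (mem_smul_stdSimplex k.cast_nonneg).1 hy
    have hbg (s : S) : b s - y s = g s := congrFun hbg s
    obtain ⟨f, hf, hgf, -⟩ := exists_integerBase_between hsub hb (l := g) (c := fun s => μ {s})
      (fun s => hbg s ▸ sub_le_self _ (hy0 s)) fun s => by simpa using hb.1.2 {s}
    have hsum : ∑ s, g s = μ Finset.univ - k := by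
      rify
      simp only [← hbg, Finset.sum_sub_distrib, hb.2, hysum]
    obtain ⟨-, -, hfS⟩ := mem_integerBases.1 hf
    refine Finset.mem_sub.2 ⟨f, hf, f - g, mem_latticeSimplex.2 ?_, sub_sub_cancel f g⟩
    simp [hgf, hfS, hsum]
  · intro hg
    obtain ⟨f, hf, h, hh, rfl⟩ := Finset.mem_sub.1 hg
    refine ⟨_, mem_integerBases_iff_cast_mem_basePolytope.1 hf, _,
      cast_mem_smul_stdSimplex.2 hh, ?_⟩
    ext s
    simp

end LatticePoints

theorem theorem2p5_general {S : Type*} [Fintype S] [DecidableEq S] [Nonempty S] (μ : Finset S → ℤ)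
    (hsub : ∀ A B : Finset S, μ (A ∪ B) + μ (A ∩ B) ≤ μ A + μ B) :
    ∃ P Q : ℚ[X],
      (∀ k : ℕ, (latticePoints (basePolytope μ + (k : ℝ) • invertedSimplex S)).Finite ∧
        P.eval (k : ℚ) =
          ((latticePoints (basePolytope μ + (k : ℝ) • invertedSimplex S)).ncard : ℚ)) ∧
      (∀ k : ℕ, (latticePoints (basePolytope μ + (k : ℝ) • stdSimplex ℝ S)).Finite ∧
        Q.eval (k : ℚ) =
          ((latticePoints (basePolytope μ + (k : ℝ) • stdSimplex ℝ S)).ncard : ℚ)) ∧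
      (∀ o : LinearOrder S,
        (interiorPolynomial μ o).natDegree ≤ Fintype.card S - 1 ∧
        (exteriorPolynomial μ o).natDegree ≤ Fintype.card S - 1 ∧
        (∀ a : Fin (Fintype.card S) → ℚ,
          P = ∑ i, C (a i) * binomPoly (Fintype.card S - 1 - (i : ℕ)) ↔
            ∀ i, a i = ((interiorPolynomial μ o).coeff (i : ℕ) : ℚ)) ∧
        (∀ a : Fin (Fintype.card S) → ℚ,
          Q = ∑ i, C (a i) * binomPoly (Fintype.card S - 1 - (i : ℕ)) ↔
            ∀ i, a i = ((exteriorPolynomial μ o).coeff (i : ℕ) : ℚ))) ∧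
      (∀ o o' : LinearOrder S,
        interiorPolynomial μ o = interiorPolynomial μ o' ∧
        exteriorPolynomial μ o = exteriorPolynomial μ o') := by
  have hB := isMConvex_integerBases hsub
  let o₀ := LinearOrder.lift' (Fintype.equivFin S) (Fintype.equivFin S).injective
  have hI (o o' : LinearOrder S) : interiorPolynomial μ o = interiorPolynomial μ o' := by
    simp only [interiorPolynomial_eq_activityPolynomial, hB.neg.activityPolynomial_eq o o']
  have hX (o o' : LinearOrder S) : exteriorPolynomial μ o = exteriorPolynomial μ o' := by
    simp only [exteriorPolynomial_eq_activityPolynomial, hB.activityPolynomial_eq o o']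
  refine ⟨binomialTransform (Fintype.card S) (interiorPolynomial μ o₀),
    binomialTransform (Fintype.card S) (exteriorPolynomial μ o₀), fun k => ?_, fun k => ?_,
    fun o => ⟨?_, ?_, fun a => ?_, fun a => ?_⟩, fun o o' => ⟨hI o o', hX o o'⟩⟩
  · rw [latticePoints_add_smul_invertedSimplex hsub, Set.ncard_coe_finset,
      interiorPolynomial_eq_activityPolynomial]
    exact ⟨Finset.finite_toSet _, hB.eval_binomialTransform_activityPolynomial_neg o₀ k⟩
  · rw [latticePoints_add_smul_stdSimplex hsub, Set.ncard_coe_finset,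
      exteriorPolynomial_eq_activityPolynomial]
    exact ⟨Finset.finite_toSet _, hB.eval_binomialTransform_activityPolynomial o₀ k⟩
  · rw [interiorPolynomial_eq_activityPolynomial]
    exact Nat.le_sub_one_of_lt (natDegree_activityPolynomial_lt _ o)
  · rw [exteriorPolynomial_eq_activityPolynomial]
    exact Nat.le_sub_one_of_lt (natDegree_activityPolynomial_lt _ o)
  · rw [hI o₀ o, binomialTransform_eq_iff]
  · rw [hX o₀ o, binomialTransform_eq_iff]

theorem theorem2p5 {S : Type*} [Fintype S] [DecidableEq S] [Nonempty S] (μ : Finset S → ℤ)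
    (hsub : ∀ A B : Finset S, μ (A ∪ B) + μ (A ∩ B) ≤ μ A + μ B)
    (hmono : ∀ A B : Finset S, A ⊆ B → μ A ≤ μ B) :
    ∃ P Q : ℚ[X],
      -- `P` and `Q` count the lattice points of `B_μ + k∇_S` and of `B_μ + kΔ_S`
      (∀ k : ℕ, (latticePoints (basePolytope μ + (k : ℝ) • invertedSimplex S)).Finite ∧
        P.eval (k : ℚ) =
          ((latticePoints (basePolytope μ + (k : ℝ) • invertedSimplex S)).ncard : ℚ)) ∧
      (∀ k : ℕ, (latticePoints (basePolytope μ + (k : ℝ) • stdSimplex ℝ S)).Finite ∧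
        Q.eval (k : ℚ) =
          ((latticePoints (basePolytope μ + (k : ℝ) • stdSimplex ℝ S)).ncard : ℚ)) ∧
      -- for every order, the coefficients of `P` and `Q` in the binomial basis exist, are unique,
      -- and are the coefficients of the interior and exterior polynomials in the standard basis
      (∀ o : LinearOrder S,
        (interiorPolynomial μ o).natDegree ≤ Fintype.card S - 1 ∧
        (exteriorPolynomial μ o).natDegree ≤ Fintype.card S - 1 ∧
        (∀ a : Fin (Fintype.card S) → ℚ,
          P = ∑ i, C (a i) * binomPoly (Fintype.card S - 1 - (i : ℕ)) ↔
            ∀ i, a i = ((interiorPolynomial μ o).coeff (i : ℕ) : ℚ)) ∧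
        (∀ a : Fin (Fintype.card S) → ℚ,
          Q = ∑ i, C (a i) * binomPoly (Fintype.card S - 1 - (i : ℕ)) ↔
            ∀ i, a i = ((exteriorPolynomial μ o).coeff (i : ℕ) : ℚ))) ∧
      -- independence of the order
      (∀ o o' : LinearOrder S,
        interiorPolynomial μ o = interiorPolynomial μ o' ∧
        exteriorPolynomial μ o = exteriorPolynomial μ o') := by
  exact theorem2p5_general μ hsub
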